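/- Let $n\ge 0$, let $A_{-1}$ be a real $n\times n$ matrix and let $A_2,A_3$ be $n\times n$-matrix-valued functions on $(-1,0)$ with entries in $L_2(-1,0)$. On the real Hilbert space $M_2=\mathbb R^n\times L_2(-1,0;\mathbb R^n)$ let $\mathcal A$ be the operator of the neutral type system $$\dot z(t)=A_{-1}\dot z(t-1)+\int_{-1}^0\left[A_2(\theta)\dot z(t+\theta)+A_3(\theta)z(t+\theta)\right]d\theta ,$$ that is, $$\mathcal A\begin{pmatrix}v\\ \varphi\end{pmatrix}=\begin{pmatrix}\int_{-1}^0\left[A_2(\theta)\varphi'(\theta)+A_3(\theta)\varphi(\theta)\right]d\theta\\ \varphi'\end{pmatrix},\qquad D(\mathcal A)=\left\{(v,\varphi):\ \varphi\in H^1([-1,0];\mathbb R^n),\ v=\varphi(0)-A_{-1}\varphi(-1)\right\},$$ and let $\mathcal A^*$ be its Hilbert space adjoint in $M_2$. Let $J\subseteq\mathbb R$ be an interval (for instance $J=[0,\infty)$ or $J=(0,\infty)$) and let $x(t)=(w(t),\psi_t)$ be a classical solution of $\dot x=\mathcal A^*x$ on $J$, i.e. $x:J\to M_2$ is continuously differentiable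 (one-sidedly at end points belonging to $J$), $x(t)\in D(\mathcal A^*)$ and $\dot x(t)=\mathcal A^*x(t)$ for all $t\in J$. Then $w$ is continuously differentiable on $J$ and, for every $t\in J$ with $t+1\in J$, the integrand below is integrable on $(-1,0)$ and $$\dot w(t+1)=A_{-1}^*\dot w(t)+\int_{-1}^0\left[A_2^*(\tau)\dot w(t+1+\tau)+A_3^*(\tau)w(t+1+\tau)\right]d\tau ,$$ where $^*$ on matrices denotes the transpose. -/

import Mathlib

open MeasureTheory Set
open scoped LinearPMap

/-- The space `ℝⁿ` with its Euclidean inner product. -/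
abbrev Vec (n : ℕ) : Type := EuclideanSpace ℝ (Fin n)

/-- Lebesgue measure on the interval `[-1, 0]` (the left end point is a null set). -/
noncomputable abbrev delayMeasure : Measure ℝ := volume.restrict (Ioc (-1 : ℝ) 0)

/-- The space `L₂(-1, 0; ℝⁿ)`. -/
abbrev HistorySpace (n : ℕ) : Type := Lp (Vec n) 2 delayMeasure

/-- The Hilbert space `M₂ = ℝⁿ × L₂(-1, 0; ℝⁿ)`, with the inner product
`⟪(v, φ), (w, ψ)⟫ = ⟪v, w⟫ + ∫ ⟪φ θ, ψ θ⟫ dθ`. -/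
abbrev StateSpace (n : ℕ) : Type := WithLp 2 (Vec n × HistorySpace n)

/-- The data of the neutral type system
`z'(t) = A₁ z'(t - 1) + ∫_{-1}^0 [A₂(θ) z'(t + θ) + A₃(θ) z(t + θ)] dθ`:
a constant matrix `A₁` (the coefficient `A_{-1}`) and two matrix functions
with entries in `L₂(-1, 0)`. -/
structure NeutralSystem (n : ℕ) where
  A₁ : Matrix (Fin n) (Fin n) ℝ
  A₂ : ℝ → Matrix (Fin n) (Fin n) ℝ
  A₃ : ℝ → Matrix (Fin n) (Fin n) ℝ
  memLp_A₂ : ∀ i j, MemLp (fun θ => A₂ θ i j) 2 delayMeasure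
  memLp_A₃ : ∀ i j, MemLp (fun θ => A₃ θ i j) 2 delayMeasure

/-- `φ ∈ H¹([-1, 0]; ℝⁿ)`, with absolutely continuous representative `f` (on `[-1, 0]`)
and derivative `g ∈ L₂(-1, 0; ℝⁿ)`. -/
def IsH1With {n : ℕ} (φ : HistorySpace n) (f : ℝ → Vec n) (g : HistorySpace n) : Prop :=
  (∀ᵐ θ ∂delayMeasure, φ θ = f θ) ∧
    ∀ θ ∈ Icc (-1 : ℝ) 0, f θ = f (-1) + ∫ s in (-1 : ℝ)..θ, g s

theorem HistorySpace.intervalIntegrable {n : ℕ} (g : HistorySpace n) :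
    IntervalIntegrable g volume (-1) 0 := by
  rw [intervalIntegrable_iff_integrableOn_Ioc_of_le (by norm_num)]
  exact (Lp.memLp g).integrable (by norm_num)

theorem HistorySpace.intervalIntegrable_of_mem {n : ℕ} (g : HistorySpace n) {θ : ℝ}
    (hθ : θ ∈ Icc (-1 : ℝ) 0) : IntervalIntegrable g volume (-1) θ :=
  g.intervalIntegrable.mono_set (by
    rw [uIcc_of_le hθ.1, uIcc_of_le (by norm_num)]
    exact Icc_subset_Icc_right hθ.2)

theorem HistorySpace.ae_of_delay {p : ℝ → Prop} (h : ∀ᵐ s ∂delayMeasure, p s) {θ : ℝ}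
    (hθ : θ ∈ Icc (-1 : ℝ) 0) : ∀ᵐ s ∂volume, s ∈ uIoc (-1 : ℝ) θ → p s := by
  rw [ae_restrict_iff' measurableSet_Ioc] at h
  filter_upwards [h] with s hs hmem
  rw [uIoc_of_le hθ.1] at hmem
  exact hs ⟨hmem.1, hmem.2.trans hθ.2⟩

theorem IsH1With.continuousOn {n : ℕ} {φ g : HistorySpace n} {f : ℝ → Vec n}
    (h : IsH1With φ f g) : ContinuousOn f (Icc (-1) 0) := by
  have h1 : ContinuousOn (fun θ => f (-1) + ∫ s in (-1 : ℝ)..θ, g s) (Icc (-1) 0) := by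
    refine continuousOn_const.add ?_
    have := intervalIntegral.continuousOn_primitive_interval (μ := volume) (f := g)
      (a := -1) (b := 0) (by
        rw [uIcc_of_le (by norm_num), integrableOn_Icc_iff_integrableOn_Ioc]
        exact (Lp.memLp g).integrable (by norm_num))
    rwa [uIcc_of_le (by norm_num)] at this
  exact h1.congr h.2

theorem IsH1With.memLp {n : ℕ} {φ g : HistorySpace n} {f : ℝ → Vec n}
    (h : IsH1With φ f g) : MemLp f 2 delayMeasure :=
  (memLp_congr_ae h.1).1 (Lp.memLp φ)

theorem IsH1With.add {n : ℕ} {φ g φ' g' : HistorySpace n} {f f' : ℝ → Vec n}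
    (h : IsH1With φ f g) (h' : IsH1With φ' f' g') :
    IsH1With (φ + φ') (f + f') (g + g') := by
  refine ⟨?_, fun θ hθ => ?_⟩
  · filter_upwards [Lp.coeFn_add φ φ', h.1, h'.1] with θ h1 h2 h3
    rw [h1, Pi.add_apply, Pi.add_apply, h2, h3]
  · have : ∫ s in (-1 : ℝ)..θ, (g + g') s = ∫ s in (-1 : ℝ)..θ, (g s + g' s) :=
      intervalIntegral.integral_congr_ae
        (HistorySpace.ae_of_delay (Lp.coeFn_add g g') hθ)
    rw [this, intervalIntegral.integral_add (g.intervalIntegrable_of_mem hθ)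
      (g'.intervalIntegrable_of_mem hθ), Pi.add_apply, Pi.add_apply, h.2 θ hθ, h'.2 θ hθ]
    abel

theorem IsH1With.smul {n : ℕ} {φ g : HistorySpace n} {f : ℝ → Vec n} (c : ℝ)
    (h : IsH1With φ f g) : IsH1With (c • φ) (c • f) (c • g) := by
  refine ⟨?_, fun θ hθ => ?_⟩
  · filter_upwards [Lp.coeFn_smul c φ, h.1] with θ h1 h2
    rw [h1, Pi.smul_apply, Pi.smul_apply, h2]
  · have : ∫ s in (-1 : ℝ)..θ, (c • g) s = ∫ s in (-1 : ℝ)..θ, c • g s :=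
      intervalIntegral.integral_congr_ae
        (HistorySpace.ae_of_delay (Lp.coeFn_smul c g) hθ)
    rw [this, intervalIntegral.integral_smul, Pi.smul_apply, Pi.smul_apply, h.2 θ hθ, smul_add]

theorem IsH1With.zero {n : ℕ} : IsH1With (0 : HistorySpace n) 0 0 := by
  have h0 := Lp.coeFn_zero (Vec n) 2 delayMeasure
  refine ⟨h0, fun θ hθ => ?_⟩
  have : ∫ s in (-1 : ℝ)..θ, (0 : HistorySpace n) s = ∫ s in (-1 : ℝ)..θ, (0 : Vec n) :=
    intervalIntegral.integral_congr_ae (HistorySpace.ae_of_delay h0 hθ)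
  rw [this]
  simp

theorem integrable_matrix_apply {n : ℕ} {A : ℝ → Matrix (Fin n) (Fin n) ℝ} {f : ℝ → Vec n}
    (hA : ∀ i j, MemLp (fun θ => A θ i j) 2 delayMeasure) (hf : MemLp f 2 delayMeasure) :
    IntervalIntegrable (fun θ => Matrix.toEuclideanLin (A θ) (f θ)) volume (-1) 0 := by
  rw [intervalIntegrable_iff_integrableOn_Ioc_of_le (by norm_num)]
  refine Integrable.of_eval_piLp fun i => ?_
  simp only [Matrix.toLpLin_apply, Matrix.mulVec, dotProduct]
  refine integrable_finsetSum _ fun j _ => ?_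
  exact (hA i j).integrable_mul (MemLp.eval_piLp hf j)

namespace NeutralSystem

variable {n : ℕ} (S : NeutralSystem n)

/-- The delay operator `L f = ∫_{-1}^0 [A₂(θ) f'(θ) + A₃(θ) f(θ)] dθ`, for a function `f`
with derivative `g`. -/
noncomputable def delayOp (f g : ℝ → Vec n) : Vec n :=
  ∫ θ in (-1 : ℝ)..0,
    (Matrix.toEuclideanLin (S.A₂ θ) (g θ) + Matrix.toEuclideanLin (S.A₃ θ) (f θ))

theorem delayOp_congr {f g f' g' : ℝ → Vec n} (hf : ∀ᵐ θ ∂delayMeasure, f θ = f' θ)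
    (hg : ∀ᵐ θ ∂delayMeasure, g θ = g' θ) : S.delayOp f g = S.delayOp f' g' := by
  refine intervalIntegral.integral_congr_ae (HistorySpace.ae_of_delay ?_ (right_mem_Icc.2 (by norm_num)))
  filter_upwards [hf, hg] with θ h1 h2
  rw [h1, h2]

theorem intervalIntegrable_delayOp {f g : ℝ → Vec n} (hf : MemLp f 2 delayMeasure)
    (hg : MemLp g 2 delayMeasure) :
    IntervalIntegrable (fun θ => Matrix.toEuclideanLin (S.A₂ θ) (g θ) +
      Matrix.toEuclideanLin (S.A₃ θ) (f θ)) volume (-1) 0 :=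
  (integrable_matrix_apply S.memLp_A₂ hg).add (integrable_matrix_apply S.memLp_A₃ hf)

theorem delayOp_add {f g f' g' : ℝ → Vec n} (hf : MemLp f 2 delayMeasure)
    (hg : MemLp g 2 delayMeasure) (hf' : MemLp f' 2 delayMeasure)
    (hg' : MemLp g' 2 delayMeasure) :
    S.delayOp (f + f') (g + g') = S.delayOp f g + S.delayOp f' g' := by
  unfold delayOp
  rw [← intervalIntegral.integral_add (S.intervalIntegrable_delayOp hf hg)
    (S.intervalIntegrable_delayOp hf' hg')]
  congr 1
  ext1 θ
  simp only [Pi.add_apply, map_add]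
  abel

theorem delayOp_smul (c : ℝ) (f g : ℝ → Vec n) :
    S.delayOp (c • f) (c • g) = c • S.delayOp f g := by
  unfold delayOp
  rw [← intervalIntegral.integral_smul]
  congr 1
  ext1 θ
  simp only [Pi.smul_apply, map_smul, smul_add]

theorem delayOp_zero : S.delayOp 0 0 = 0 := by
  simp [delayOp]

/-- The graph of the operator `𝒜 (v, φ) = (L φ, φ')` whose domain consists of the `(v, φ)` with
`φ ∈ H¹` and `v = φ(0) - A₁ φ(-1)`. -/
def generatorGraph : Submodule ℝ (StateSpace n × StateSpace n) where
  carrier := {p | ∃ f : ℝ → Vec n, IsH1With p.1.snd f p.2.snd ∧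
    p.1.fst = f 0 - Matrix.toEuclideanLin S.A₁ (f (-1)) ∧
    p.2.fst = S.delayOp f p.2.snd}
  zero_mem' := by
    refine ⟨0, IsH1With.zero, by simp, ?_⟩
    exact (S.delayOp_zero).symm.trans
      (S.delayOp_congr (by simp) (Filter.EventuallyEq.symm (Lp.coeFn_zero (Vec n) 2 delayMeasure)))
  add_mem' := by
    rintro p q ⟨f, hf, h1, h2⟩ ⟨f', hf', h1', h2'⟩
    refine ⟨f + f', hf.add hf', ?_, ?_⟩
    · simp only [Prod.fst_add, WithLp.add_fst, h1, h1', Pi.add_apply, map_add]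
      abel
    · simp only [Prod.snd_add, WithLp.add_fst, WithLp.add_snd, h2, h2']
      rw [← S.delayOp_add hf.memLp (Lp.memLp _) hf'.memLp (Lp.memLp _)]
      exact S.delayOp_congr (by simp) (Filter.EventuallyEq.symm (Lp.coeFn_add _ _))
  smul_mem' := by
    rintro c p ⟨f, hf, h1, h2⟩
    refine ⟨c • f, hf.smul c, ?_, ?_⟩
    · simp only [Prod.smul_fst, WithLp.smul_fst, h1, Pi.smul_apply, map_smul, smul_sub]
    · simp only [Prod.smul_snd, WithLp.smul_fst, WithLp.smul_snd, h2]
      rw [← S.delayOp_smul]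
      exact S.delayOp_congr (by simp) (Filter.EventuallyEq.symm (Lp.coeFn_smul _ _))

/-- The generator `𝒜` of the neutral type system, as an unbounded operator in `M₂`. -/
noncomputable def generator : StateSpace n →ₗ.[ℝ] StateSpace n :=
  S.generatorGraph.toLinearPMap

end NeutralSystem

theorem IsH1With.eq_zero {n : ℕ} {g : HistorySpace n} {f : ℝ → Vec n}
    (h : IsH1With 0 f g) : (∀ θ ∈ Icc (-1 : ℝ) 0, f θ = 0) ∧ g = 0 := by
  have h0 : f =ᵐ[delayMeasure] fun _ => (0 : Vec n) := by
    filter_upwards [h.1, Lp.coeFn_zero (Vec n) 2 delayMeasure] with θ h1 h2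
    rw [← h1, h2, Pi.zero_apply]
  have hf : EqOn f (fun _ => (0 : Vec n)) (Icc (-1) 0) := by
    refine Measure.eqOn_Icc_of_ae_eq (μ := volume) (by norm_num) ?_ h.continuousOn
      continuousOn_const
    rwa [delayMeasure, restrict_Ioc_eq_restrict_Icc] at h0
  refine ⟨hf, ?_⟩
  have hint : ∀ θ ∈ Icc (-1 : ℝ) 0, ∫ s in (-1 : ℝ)..θ, g s = 0 := fun θ hθ => by
    have := h.2 θ hθ
    rw [hf hθ, hf (by simp : (-1 : ℝ) ∈ Icc (-1 : ℝ) 0)] at this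
    simpa using this.symm
  refine (Lp.eq_zero_iff_ae_eq_zero).2 ?_
  have hd := g.intervalIntegrable.ae_hasDerivAt_integral
  rw [Filter.EventuallyEq, ae_restrict_iff' measurableSet_Ioc]
  have hne : ∀ᵐ s ∂(volume : Measure ℝ), s ≠ 0 := by simp [ae_iff]
  filter_upwards [hd, hne] with s hs hs0 hmem
  have hd1 := hs (by rw [uIcc_of_le (by norm_num)]; exact Ioc_subset_Icc_self hmem) (-1)
    (by simp)
  have hlt : s < 0 := lt_of_le_of_ne hmem.2 hs0
  have hd2 : HasDerivAt (fun _ : ℝ => (0 : Vec n)) (g s) s := by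
    refine hd1.congr_of_eventuallyEq ?_
    filter_upwards [Icc_mem_nhds hmem.1 hlt] with θ hθ
    exact (hint θ hθ).symm
  exact hd2.unique (hasDerivAt_const s 0)

/-- The graph above is single-valued, so it is the graph of the generator. -/
theorem NeutralSystem.graph_generator {n : ℕ} (S : NeutralSystem n) :
    S.generator.graph = S.generatorGraph := by
  refine Submodule.toLinearPMap_graph_eq _ ?_
  rintro ⟨p, q⟩ ⟨f, hf, -, h2⟩ hp
  dsimp only at hf h2 hp ⊢
  subst hp
  obtain ⟨h3, h4⟩ := IsH1With.eq_zero hf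
  have hq : q.fst = 0 := by
    rw [h2]
    rw [← S.delayOp_zero]
    refine S.delayOp_congr ?_ ?_
    · rw [ae_restrict_iff' measurableSet_Ioc]
      exact Filter.Eventually.of_forall fun θ hθ => h3 θ (Ioc_subset_Icc_self hθ)
    · rw [h4]
      exact Lp.coeFn_zero (Vec n) 2 delayMeasure
  exact WithLp.ofLp_injective 2 (Prod.ext hq h4)

/-- `x` is a classical solution of `x' = A x` on the time interval `J`: it is continuously
differentiable on `J` (one-sidedly at end points that belong to `J`), with values in the domain
of `A`, and satisfies the equation at every time of `J`. -/
structure IsClassicalSolutionOn {X : Type*} [NormedAddCommGroup X] [NormedSpace ℝ X]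
    (A : X →ₗ.[ℝ] X) (x : ℝ → X) (J : Set ℝ) : Prop where
  mem_domain : ∀ t ∈ J, x t ∈ A.domain
  hasDerivWithinAt : ∀ t (ht : t ∈ J), HasDerivWithinAt x (A ⟨x t, mem_domain t ht⟩) J t
  continuousOn_deriv : ContinuousOn (derivWithin x J) J

/-! Write `y = (w, ψ)` and `z = 𝒜* y = (u, χ)`. Testing the adjoint relation with constants and with
ramps shows that `A₂ᵀ w + ψ` coincides almost everywhere with the continuous function `q(θ) = u -
∫_θ^0 (A₃ᵀ w - χ)`, and that `q(-1) = A₁ᵀ u` (`integral_adjoint_profile`,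
`integral_adjoint_defect`).

Along a solution `u = w'` and `χ = ψ'`, so `q` is transported along characteristics. Fix `s` and
differentiate `r ↦ ∫_{r-s}^0 (A₂ᵀ w(r) + ψ_r)`: the moving end point gives `-q`, the time derivative
gives `q` plus terms in `w` and `w'` alone, and `q` cancels
(`hasDerivWithinAt_profileIntegral_characteristic`). Integrate over `[a, s]` and apply Fubini
(`integral_primitive_eq_integral_volterra`). This yields the `s`-integrated form of `w'(σ) -
∫_{a-σ}^0 [A₂ᵀ w'(σ+τ) + A₃ᵀ w(σ+τ)] dτ = q_a(a-σ)`. Both sides are continuous in `σ`, so the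
identity holds pointwise; at `σ = a + 1` the right side is `q_a(-1) = A₁ᵀ w'(a)`.

Only integrals of `A₂ᵀ w + ψ` are differentiated, because `A₂` and `ψ` are merely `L₂`. -/

/-! ### Fubini on a triangle and functions cut off to a window -/

/-- Fubini's theorem on the triangle `a < t < σ ≤ b`. -/
theorem intervalIntegral_triangle_swap {E : Type*} [NormedAddCommGroup E] [NormedSpace ℝ E]
    {F : ℝ → ℝ → E} {a b : ℝ} (hab : a ≤ b)
    (hF : IntegrableOn (Function.uncurry F)
      {p | p.1 ∈ Ioc a b ∧ p.2 ∈ Ioc a b ∧ p.1 < p.2} (volume.prod volume)) :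
    ∫ t in a..b, ∫ σ in t..b, F t σ = ∫ σ in a..b, ∫ t in a..σ, F t σ := by
  set F' : ℝ → ℝ → E := fun t σ => if t < σ then F t σ else 0 with hF'
  have hmeas : MeasurableSet {p : ℝ × ℝ | p.1 < p.2} :=
    measurableSet_lt measurable_fst measurable_snd
  have hint : Integrable (Function.uncurry F')
      ((volume.restrict (uIoc a b)).prod (volume.restrict (uIoc a b))) := by
    rw [Measure.prod_restrict, uIoc_of_le hab]
    have : Function.uncurry F' = indicator {p : ℝ × ℝ | p.1 < p.2} (Function.uncurry F) := by
      ext ⟨t, σ⟩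
      simp [hF', indicator]
    rw [this, integrable_indicator_iff hmeas, IntegrableOn, Measure.restrict_restrict hmeas]
    refine hF.mono_set ?_
    rintro ⟨t, σ⟩ ⟨h1, h2, h3⟩
    exact ⟨h2, h3, h1⟩
  have h1 : ∀ t ∈ uIcc a b, ∫ σ in t..b, F t σ = ∫ σ in a..b, F' t σ := by
    intro t ht
    rw [uIcc_of_le hab] at ht
    rw [intervalIntegral.integral_of_le ht.2, intervalIntegral.integral_of_le hab,
      ← integral_indicator measurableSet_Ioc, ← integral_indicator measurableSet_Ioc]
    congr 1
    ext σ
    simp only [indicator, hF', mem_Ioc]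
    have := ht.1
    split_ifs <;> first | rfl | (exfalso; grind)
  have h2 : ∀ σ ∈ uIcc a b, ∫ t in a..σ, F t σ = ∫ t in a..b, F' t σ := by
    intro σ hσ
    rw [uIcc_of_le hab] at hσ
    -- The cut-off `t < σ` is strict, so the null end point `t = σ` is removed first.
    rw [intervalIntegral.integral_of_le hσ.1, intervalIntegral.integral_of_le hab,
      integral_Ioc_eq_integral_Ioo,
      ← integral_indicator measurableSet_Ioo, ← integral_indicator measurableSet_Ioc]
    congr 1
    ext t
    simp only [indicator, hF', mem_Ioc, mem_Ioo]
    have := hσ.2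
    split_ifs <;> first | rfl | (exfalso; grind)
  rw [intervalIntegral.integral_congr h1, intervalIntegral.integral_congr h2]
  exact intervalIntegral_intervalIntegral_swap (by
    rwa [IntegrableOn, Measure.volume_eq_prod, ← Measure.prod_restrict])

theorem aestronglyMeasurable_indicator_Ioc {E : Type*} [NormedAddCommGroup E] {u : ℝ → E} {a b : ℝ}
    (hu : ContinuousOn u (Icc a b)) :
    AEStronglyMeasurable ((Ioc a b).indicator u) volume :=
  (aestronglyMeasurable_indicator_iff measurableSet_Ioc).2
    ((hu.mono Ioc_subset_Icc_self).aestronglyMeasurable measurableSet_Ioc)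

theorem exists_norm_indicator_Ioc_le {E : Type*} [NormedAddCommGroup E] {u : ℝ → E} {a b : ℝ} (hu : ContinuousOn u (Icc a b)) :
    ∃ C, ∀ t, ‖(Ioc a b).indicator u t‖ ≤ C := by
  obtain ⟨C, hC⟩ := isCompact_Icc.exists_bound_of_continuousOn hu
  refine ⟨max C 0, fun t => ?_⟩
  by_cases ht : t ∈ Ioc a b
  · rw [indicator_of_mem ht]
    exact (hC t (Ioc_subset_Icc_self ht)).trans (le_max_left _ _)
  · rw [indicator_of_notMem ht]
    simp

/-! ### Volterra integrals with an integrable operator kernel -/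

section Volterra

variable {E F : Type*} [NormedAddCommGroup E] [NormedSpace ℝ E] [NormedAddCommGroup F]
  [NormedSpace ℝ F]

/-- Extending `u` by zero makes the limits independent of `σ`: for `τ ≤ 0` the bound `σ + τ ≤ a + 1`
is automatic, and `a < σ + τ` is the lower limit. -/
theorem integral_volterra_eq_indicator (K : ℝ → E →L[ℝ] F) (u : ℝ → E) {a σ : ℝ}
    (hσ : σ ∈ Icc a (a + 1)) :
    ∫ τ in (a - σ)..0, K τ (u (σ + τ)) =
      ∫ τ in (-1 : ℝ)..0, K τ ((Ioc a (a + 1)).indicator u (σ + τ)) := by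
  rw [intervalIntegral.integral_of_le (by linarith [hσ.1]),
    intervalIntegral.integral_of_le (by norm_num),
    ← integral_indicator measurableSet_Ioc, ← integral_indicator measurableSet_Ioc]
  congr 1
  ext τ
  have h1 := hσ.1
  have h2 := hσ.2
  simp only [indicator, mem_Ioc]
  split_ifs <;> first | rfl | (exfalso; grind) | simp

/-- Dominated convergence with bound `‖K τ‖ * C`. -/
theorem continuousOn_volterra {K : ℝ → E →L[ℝ] F} {u : ℝ → E} {a : ℝ}
    (hK : IntegrableOn K (Ioc (-1) 0)) (hu : ContinuousOn u (Icc a (a + 1))) :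
    ContinuousOn (fun σ => ∫ τ in (a - σ)..0, K τ (u (σ + τ))) (Icc a (a + 1)) := by
  refine ContinuousOn.congr (f := fun σ => ∫ τ in (-1 : ℝ)..0,
    K τ ((Ioc a (a + 1)).indicator u (σ + τ))) ?_ fun σ hσ => integral_volterra_eq_indicator K u hσ
  refine Continuous.continuousOn ?_
  simp only [intervalIntegral.integral_of_le (show (-1 : ℝ) ≤ 0 by norm_num)]
  obtain ⟨C, hC⟩ := exists_norm_indicator_Ioc_le hu
  refine continuous_iff_continuousAt.2 fun σ₀ => ?_
  refine continuousAt_of_dominated (bound := fun τ => ‖K τ‖ * C) ?_ ?_ (hK.norm.mul_const C) ?_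
  · refine Filter.Eventually.of_forall fun σ => ?_
    refine isBoundedBilinearMap_apply.continuous.comp_aestronglyMeasurable
      (hK.aestronglyMeasurable.prodMk ?_)
    exact ((aestronglyMeasurable_indicator_Ioc hu).comp_quasiMeasurePreserving
      (measurePreserving_add_left volume σ).quasiMeasurePreserving).restrict
  · refine Filter.Eventually.of_forall fun σ => Filter.Eventually.of_forall fun τ => ?_
    exact (K τ).le_opNorm_of_le (hC _)
  · refine ae_restrict_of_ae ?_
    -- The zero extension of `u` can jump only at the two ends of the window, which excludes two
    -- values of `τ`.
    have h1 : ∀ᵐ τ ∂(volume : Measure ℝ), τ ≠ a - σ₀ := by simp [ae_iff]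
    have h2 : ∀ᵐ τ ∂(volume : Measure ℝ), τ ≠ a + 1 - σ₀ := by simp [ae_iff]
    filter_upwards [h1, h2] with τ hτ1 hτ2
    refine (K τ).continuous.continuousAt.comp ?_
    refine ContinuousAt.comp (g := (Ioc a (a + 1)).indicator u) (f := fun σ => σ + τ) ?_
      (continuous_id.add continuous_const).continuousAt
    have hne1 : σ₀ + τ ≠ a := fun h => hτ1 (by linarith)
    have hne2 : σ₀ + τ ≠ a + 1 := fun h => hτ2 (by linarith)
    by_cases hmem : σ₀ + τ ∈ Ioc a (a + 1)
    · have hn : Icc a (a + 1) ∈ nhds (σ₀ + τ) :=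
        Icc_mem_nhds hmem.1 (lt_of_le_of_ne hmem.2 hne2)
      refine (hu.continuousAt hn).congr ?_
      filter_upwards [Ioo_mem_nhds hmem.1 (lt_of_le_of_ne hmem.2 hne2)] with x hx
      rw [indicator_of_mem (Ioo_subset_Ioc_self hx)]
    · have hn : (Icc a (a + 1))ᶜ ∈ nhds (σ₀ + τ) := by
        refine isClosed_Icc.isOpen_compl.mem_nhds fun h => hmem ⟨lt_of_le_of_ne h.1 hne1.symm, h.2⟩
      refine (continuousAt_const (y := (0 : E))).congr ?_
      filter_upwards [hn] with x hx
      rw [indicator_of_notMem fun h => hx (Ioc_subset_Icc_self h)]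

/-- With `τ = t - σ`, both sides are iterated integrals of `K (t - σ) (u t)` over the triangle `a <
t < σ ≤ s`. -/
theorem integral_primitive_eq_integral_volterra [CompleteSpace F]
    {K : ℝ → E →L[ℝ] F} {u : ℝ → E} {a s : ℝ} (hK : IntegrableOn K (Ioc (-1) 0))
    (hu : ContinuousOn u (Icc a (a + 1))) (hs : s ∈ Icc a (a + 1)) :
    ∫ t in a..s, (∫ τ in (t - s)..0, K τ) (u t) =
      ∫ σ in a..s, ∫ τ in (a - σ)..0, K τ (u (σ + τ)) := by
  have h1 : ∀ t ∈ uIcc a s, (∫ τ in (t - s)..0, K τ) (u t) = ∫ σ in t..s, K (t - σ) (u t) := by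
    intro t ht
    rw [uIcc_of_le hs.1] at ht
    rw [intervalIntegral.integral_comp_sub_left (fun τ => K τ (u t)) t, sub_self,
      ContinuousLinearMap.intervalIntegral_apply]
    rw [intervalIntegrable_iff_integrableOn_Ioc_of_le (by linarith [ht.2])]
    exact hK.mono_set (Ioc_subset_Ioc_left (by linarith [ht.1, hs.2]))
  have h2 : ∀ σ ∈ uIcc a s, ∫ τ in (a - σ)..0, K τ (u (σ + τ)) =
      ∫ t in a..σ, K (t - σ) (u t) := by
    intro σ _
    have := intervalIntegral.integral_comp_sub_right (fun τ => K τ (u (σ + τ))) σ (a := a) (b := σ)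
    rw [sub_self] at this
    rw [← this]
    simp
  rw [intervalIntegral.integral_congr h1, intervalIntegral.integral_congr h2]
  refine intervalIntegral_triangle_swap hs.1 ?_
  have hU : Integrable ((Ioc a (a + 1)).indicator u) volume := by
    rw [integrable_indicator_iff measurableSet_Ioc]
    exact (hu.integrableOn_Icc).mono_set Ioc_subset_Icc_self
  have hk : Integrable (fun x => (Ioc (-1 : ℝ) 0).indicator K (-x)) volume :=
    ((integrable_indicator_iff measurableSet_Ioc).2 hK).comp_neg
  -- On the triangle the integrand is that of the convolution of the cut-off `u` with the reflected
  -- cut-off `K`, hence jointly integrable.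
  have hc := (hU.convolution_integrand (ContinuousLinearMap.apply ℝ F) hk).swap
  refine (hc.integrableOn (s := {p | p.1 ∈ Ioc a s ∧ p.2 ∈ Ioc a s ∧ p.1 < p.2})).congr_fun ?_ ?_
  · rintro ⟨t, σ⟩ ⟨ht, hσ, hlt⟩
    dsimp only at ht hσ hlt
    have hs2 := hs.2
    have m1 : t ∈ Ioc a (a + 1) := ⟨ht.1, ht.2.trans hs2⟩
    have m2 : t - σ ∈ Ioc (-1 : ℝ) 0 :=
      ⟨by linarith [ht.1, hσ.2], by linarith⟩
    simp only [Function.comp_apply, Prod.swap_prod_mk, neg_sub, indicator_of_mem m1, indicator_of_mem m2,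
      ContinuousLinearMap.apply_apply, Function.uncurry_apply_pair]
  · exact (measurable_fst measurableSet_Ioc).inter ((measurable_snd measurableSet_Ioc).inter
      (measurableSet_lt measurable_fst measurable_snd))

end Volterra

/-! ### The coefficient matrices as operator-valued functions -/

section Coefficients

variable {n : ℕ}

/-- The matrix function `A`, transposed pointwise and viewed as an operator-valued function. -/
noncomputable def transposeCLM (A : ℝ → Matrix (Fin n) (Fin n) ℝ) (τ : ℝ) : Vec n →L[ℝ] Vec n :=
  Matrix.toEuclideanCLM (n := Fin n) (𝕜 := ℝ) (A τ).transpose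

theorem transposeCLM_apply (A : ℝ → Matrix (Fin n) (Fin n) ℝ) (τ : ℝ) (v : Vec n) :
    transposeCLM A τ v = Matrix.toEuclideanLin (A τ).transpose v := rfl

theorem inner_toEuclideanLin (A : Matrix (Fin n) (Fin n) ℝ) (v w : Vec n) :
    inner ℝ w (Matrix.toEuclideanLin A v) =
      inner ℝ (Matrix.toEuclideanLin A.transpose w) v := by
  have h := LinearMap.adjoint_inner_left (Matrix.toEuclideanLin A) v w
  rw [← Matrix.toEuclideanLin_conjTranspose_eq_adjoint,
    Matrix.conjTranspose_eq_transpose_of_trivial] at h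
  exact h.symm

theorem memLp_sum_entries_smul {E : Type*} [NormedAddCommGroup E] [NormedSpace ℝ E]
    {A : ℝ → Matrix (Fin n) (Fin n) ℝ} (hA : ∀ i j, MemLp (fun θ => A θ i j) 2 delayMeasure)
    (M : Fin n → Fin n → E) : MemLp (fun θ => ∑ i, ∑ j, A θ j i • M i j) 2 delayMeasure :=
  memLp_finsetSum _ fun i _ => memLp_finsetSum _ fun j _ =>
    (ContinuousLinearMap.toSpanSingleton ℝ (M i j)).comp_memLp' (hA j i)

/-- Expanding in matrix units reduces the operator norm to the finitely many `L₂` entries. -/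
theorem memLp_transposeCLM {A : ℝ → Matrix (Fin n) (Fin n) ℝ}
    (hA : ∀ i j, MemLp (fun θ => A θ i j) 2 delayMeasure) :
    MemLp (transposeCLM A) 2 delayMeasure := by
  let L : Matrix (Fin n) (Fin n) ℝ →ₗ[ℝ] Vec n →L[ℝ] Vec n :=
    (Matrix.toEuclideanCLM (n := Fin n) (𝕜 := ℝ)).toAlgEquiv.toLinearMap
  have h : transposeCLM A = fun θ => ∑ i, ∑ j, A θ j i • L (Matrix.single i j (1 : ℝ)) := by
    ext1 θ
    change L (A θ).transpose = _
    conv_lhs => rw [Matrix.matrix_eq_sum_single (A θ).transpose]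
    simp only [map_sum, Matrix.transpose_apply]
    refine Finset.sum_congr rfl fun i _ => Finset.sum_congr rfl fun j _ => ?_
    rw [← L.map_smul, Matrix.smul_single, smul_eq_mul, mul_one]
  rw [h]
  exact memLp_sum_entries_smul hA fun i j => L (Matrix.single i j (1 : ℝ))

theorem memLp_transposeCLM_apply {A : ℝ → Matrix (Fin n) (Fin n) ℝ}
    (hA : ∀ i j, MemLp (fun θ => A θ i j) 2 delayMeasure) (v : Vec n) :
    MemLp (fun θ => transposeCLM A θ v) 2 delayMeasure :=
  (ContinuousLinearMap.apply ℝ (Vec n) v).comp_memLp' (memLp_transposeCLM hA)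

theorem MeasureTheory.MemLp.intervalIntegrable_delay {E : Type*} [NormedAddCommGroup E] {f : ℝ → E}
    (hf : MemLp f 2 delayMeasure) {a b : ℝ} (ha : a ∈ Icc (-1 : ℝ) 0) (hb : b ∈ Icc (-1 : ℝ) 0) :
    IntervalIntegrable f volume a b := by
  have h : IntegrableOn f (Ioc (-1) 0) := hf.integrable (by norm_num)
  exact intervalIntegrable_iff.2 (h.mono_set (by
    rw [uIoc]
    exact Ioc_subset_Ioc (le_min ha.1 hb.1) (max_le ha.2 hb.2)))

theorem Continuous.memLp_delay {E : Type*} [NormedAddCommGroup E] {f : ℝ → E} (hf : Continuous f) :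
    MemLp f 2 delayMeasure := by
  obtain ⟨C, hC⟩ := isCompact_Icc.exists_bound_of_continuousOn (hf.continuousOn (s := Icc (-1) 0))
  refine MemLp.of_bound (Continuous.aestronglyMeasurable hf) C ?_
  rw [ae_restrict_iff' measurableSet_Ioc]
  exact Filter.Eventually.of_forall fun θ hθ => hC θ (Ioc_subset_Icc_self hθ)

end Coefficients

/-! ### Ramp functions as `H¹` test functions -/

section Ramp

variable {E : Type*} [NormedAddCommGroup E] [NormedSpace ℝ E] [CompleteSpace E]

theorem integral_indicator_Ioi_const (c : E) {θ x : ℝ} (hθ : -1 ≤ θ) (hx : -1 ≤ x) :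
    ∫ r in (-1 : ℝ)..x, (Ioi θ).indicator (fun _ => c) r = max (x - θ) 0 • c := by
  rw [intervalIntegral.integral_of_le hx, setIntegral_indicator measurableSet_Ioi,
    Ioc_inter_Ioi, setIntegral_const, Real.volume_real_Ioc, max_eq_right hθ]

/-- Fubini on the triangle `θ < s < r ≤ 0`, since `r - θ = ∫_θ^r ds`. -/
theorem integral_sub_smul_eq {h : ℝ → E} {θ : ℝ} (hθ : θ ≤ 0)
    (hh : IntervalIntegrable h volume θ 0) :
    ∫ r in θ..0, (r - θ) • h r = ∫ s in θ..0, ∫ r in s..0, h r := by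
  rw [intervalIntegral_triangle_swap hθ]
  · simp
  · rw [intervalIntegrable_iff_integrableOn_Ioc_of_le hθ] at hh
    have h1 : IntegrableOn (Function.uncurry fun _ : ℝ => h) (Ioc θ 0 ×ˢ Ioc θ 0)
        (volume.prod volume) := by
      rw [IntegrableOn, ← Measure.prod_restrict]
      exact Integrable.comp_snd hh _
    exact h1.mono_set fun p hp => ⟨hp.1, hp.2.1⟩

end Ramp

/-! ### Consequences of the adjoint relation -/

namespace NeutralSystem

variable {n : ℕ} (S : NeutralSystem n)

/-- The integral form of the adjoint relation, tested against `f ∈ H¹` with derivative `g`. -/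
theorem adjoint_relation_integral {y z : StateSpace n}
    (hyz : ∀ p ∈ S.generatorGraph, inner ℝ y p.2 = inner ℝ z p.1) {f g : ℝ → Vec n}
    (hf : MemLp f 2 delayMeasure) (hg : MemLp g 2 delayMeasure)
    (hfg : ∀ θ ∈ Icc (-1 : ℝ) 0, f θ = f (-1) + ∫ s in (-1 : ℝ)..θ, g s) :
    (∫ r in (-1 : ℝ)..0, inner ℝ (transposeCLM S.A₂ r y.fst + y.snd r) (g r)) +
      (∫ r in (-1 : ℝ)..0, inner ℝ (transposeCLM S.A₃ r y.fst - z.snd r) (f r)) =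
      inner ℝ z.fst (f 0 - Matrix.toEuclideanLin S.A₁ (f (-1))) := by
  set φ : HistorySpace n := hf.toLp f with hφ
  set γ : HistorySpace n := hg.toLp g with hγ
  have hφf : ∀ᵐ θ ∂delayMeasure, φ θ = f θ := hf.coeFn_toLp
  have hγg : ∀ᵐ θ ∂delayMeasure, γ θ = g θ := hg.coeFn_toLp
  have hH : IsH1With φ f γ := by
    refine ⟨hφf, fun θ hθ => ?_⟩
    rw [hfg θ hθ, intervalIntegral.integral_congr_ae (HistorySpace.ae_of_delay hγg hθ)]
  have key := hyz (WithLp.toLp 2 (f 0 - Matrix.toEuclideanLin S.A₁ (f (-1)), φ),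
    WithLp.toLp 2 (S.delayOp f γ, γ)) ⟨f, hH, rfl, rfl⟩
  rw [WithLp.prod_inner_apply, WithLp.prod_inner_apply] at key
  dsimp only at key
  have hI : ∀ {p q : ℝ → Vec n}, MemLp p 2 delayMeasure → MemLp q 2 delayMeasure →
      IntervalIntegrable (fun r => (inner ℝ (p r) (q r) : ℝ)) volume (-1) 0 := by
    intro p q hp hq
    rw [intervalIntegrable_iff_integrableOn_Ioc_of_le (by norm_num)]
    refine (L2.integrable_inner (𝕜 := ℝ) hp.toLp hq.toLp).congr ?_
    filter_upwards [hp.coeFn_toLp, hq.coeFn_toLp] with r h1 h2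
    rw [h1, h2]
  have e1 : inner ℝ y.fst (S.delayOp f γ) =
      (∫ r in (-1 : ℝ)..0, inner ℝ (transposeCLM S.A₂ r y.fst) (g r)) +
        ∫ r in (-1 : ℝ)..0, inner ℝ (transposeCLM S.A₃ r y.fst) (f r) := by
    rw [S.delayOp_congr (Filter.Eventually.of_forall fun _ => rfl) hγg, delayOp,
      ← intervalIntegral.integral_add (hI (memLp_transposeCLM_apply S.memLp_A₂ _) hg)
        (hI (memLp_transposeCLM_apply S.memLp_A₃ _) hf),
      intervalIntegral.integral_of_le (by norm_num), ← integral_inner,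
      intervalIntegral.integral_of_le (by norm_num)]
    · simp only [inner_add_right, inner_toEuclideanLin, transposeCLM_apply]
    · have := S.intervalIntegrable_delayOp hf hg
      rwa [intervalIntegrable_iff_integrableOn_Ioc_of_le (by norm_num)] at this
  have e2 : ∀ (p φ : HistorySpace n) (f : ℝ → Vec n), (∀ᵐ θ ∂delayMeasure, φ θ = f θ) →
      inner ℝ p φ = ∫ r in (-1 : ℝ)..0, inner ℝ (p r) (f r) := by
    intro p φ f h
    rw [L2.inner_def, intervalIntegral.integral_of_le (by norm_num)]
    exact integral_congr_ae (h.mono fun r hr => by simp only [hr])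
  have e3 := e2 y.snd γ g hγg
  have e4 := e2 z.snd φ f hφf
  simp only [inner_add_left, inner_sub_left]
  rw [intervalIntegral.integral_add (hI (memLp_transposeCLM_apply S.memLp_A₂ _) hg)
    (hI (Lp.memLp _) hg), intervalIntegral.integral_sub
    (hI (memLp_transposeCLM_apply S.memLp_A₃ _) hf) (hI (Lp.memLp _) hf)]
  change inner ℝ y.fst (S.delayOp f γ) + inner ℝ y.snd γ =
    inner ℝ z.fst (f 0 - Matrix.toEuclideanLin S.A₁ (f (-1))) + inner ℝ z.snd φ at key
  rw [e1, e3, e4] at key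
  linarith

theorem memLp_adjoint_defect (w : Vec n) (χ : HistorySpace n) :
    MemLp (fun r => transposeCLM S.A₃ r w - χ r) 2 delayMeasure :=
  (memLp_transposeCLM_apply S.memLp_A₃ w).sub (Lp.memLp χ)

theorem memLp_adjoint_profile (w : Vec n) (ψ : HistorySpace n) :
    MemLp (fun r => transposeCLM S.A₂ r w + ψ r) 2 delayMeasure :=
  (memLp_transposeCLM_apply S.memLp_A₂ w).add (Lp.memLp ψ)

/-- The boundary condition satisfied by the domain of the adjoint. -/
theorem integral_adjoint_defect {y z : StateSpace n}
    (hyz : ∀ p ∈ S.generatorGraph, inner ℝ y p.2 = inner ℝ z p.1) :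
    ∫ r in (-1 : ℝ)..0, (transposeCLM S.A₃ r y.fst - z.snd r) =
      z.fst - Matrix.toEuclideanLin S.A₁.transpose z.fst := by
  refine ext_inner_right ℝ fun c => ?_
  -- For constant test functions the `A₂` and `ψ` terms disappear.
  have h := S.adjoint_relation_integral hyz (f := fun _ => c) (g := fun _ => 0)
    (memLp_const c) (memLp_const 0) (by simp)
  have hI := (S.memLp_adjoint_defect y.fst z.snd).intervalIntegrable_delay
    (a := -1) (b := 0) (by simp) (by simp)
  rw [intervalIntegrable_iff_integrableOn_Ioc_of_le (by norm_num)] at hI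
  rw [real_inner_comm, intervalIntegral.integral_of_le (by norm_num), ← integral_inner hI,
    inner_sub_left, ← inner_toEuclideanLin, ← inner_sub_right, ← h,
    intervalIntegral.integral_of_le (by norm_num), intervalIntegral.integral_of_le (by norm_num)]
  simp [real_inner_comm]

/-- The regularity of the domain of the adjoint: `A₂ᵀ w + ψ` is almost everywhere equal to the
absolutely continuous function `θ ↦ u - ∫_θ^0 (A₃ᵀ w - χ)`. -/
theorem integral_adjoint_profile {y z : StateSpace n}
    (hyz : ∀ p ∈ S.generatorGraph, inner ℝ y p.2 = inner ℝ z p.1) {θ : ℝ}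
    (hθ : θ ∈ Icc (-1 : ℝ) 0) :
    ∫ r in θ..0, (transposeCLM S.A₂ r y.fst + y.snd r) =
      ∫ s in θ..0, (z.fst - ∫ r in s..0, (transposeCLM S.A₃ r y.fst - z.snd r)) := by
  have hm0 : (0 : ℝ) ∈ Icc (-1 : ℝ) 0 := by simp
  have hP := (S.memLp_adjoint_profile y.fst y.snd).intervalIntegrable_delay hθ hm0
  have hD := (S.memLp_adjoint_defect y.fst z.snd).intervalIntegrable_delay hθ hm0
  set P : ℝ → Vec n := fun r => transposeCLM S.A₂ r y.fst + y.snd r with hPdef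
  set D : ℝ → Vec n := fun r => transposeCLM S.A₃ r y.fst - z.snd r with hDdef
  have hprim : IntervalIntegrable (fun s => ∫ r in s..0, D r) volume θ 0 := by
    refine ContinuousOn.intervalIntegrable ?_
    have := intervalIntegral.continuousOn_primitive_interval_left (μ := volume) (f := D)
      (a := θ) (b := 0) (by
        rw [uIcc_of_le hθ.2, integrableOn_Icc_iff_integrableOn_Ioc]
        rwa [intervalIntegrable_iff_integrableOn_Ioc_of_le hθ.2] at hD)
    exact this
  rw [intervalIntegral.integral_sub intervalIntegrable_const hprim,
    intervalIntegral.integral_const, ← integral_sub_smul_eq hθ.2 hD, eq_sub_iff_add_eq]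
  refine ext_inner_right ℝ fun c => ?_
  have hcont : Continuous fun r : ℝ => max (r - θ) 0 • c := by fun_prop
  -- The ramp vanishes at `-1`, which removes the `A₁` term, equals `-θ • c` at `0`, and has
  -- derivative `c` exactly on `(θ, 0]`.
  have h := S.adjoint_relation_integral hyz (f := fun r => max (r - θ) 0 • c)
    (g := (Ioi θ).indicator fun _ => c) hcont.memLp_delay
    ((memLp_const c).indicator measurableSet_Ioi) (fun x hx => by
      rw [integral_indicator_Ioi_const c hθ.1 hx.1, max_eq_right (by linarith [hθ.1] : -1 - θ ≤ 0)]
      simp)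
  have hI : ∀ F : ℝ → ℝ, (∀ r ≤ θ, F r = 0) → ∫ r in (-1 : ℝ)..0, F r = ∫ r in θ..0, F r := by
    intro F hF
    rw [intervalIntegral.integral_of_le (by norm_num), intervalIntegral.integral_of_le hθ.2]
    refine setIntegral_eq_of_subset_of_forall_sdiff_eq_zero measurableSet_Ioc
      (Ioc_subset_Ioc_left hθ.1) fun r hr => hF r ?_
    by_contra! hlt
    exact hr.2 ⟨hlt, hr.1.2⟩
  rw [hI _ (fun r hr => by simp [indicator, hr.not_gt]),
    hI _ (fun r hr => by simp [max_eq_right (sub_nonpos.2 hr)])] at h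
  have hD2 : IntervalIntegrable (fun r => (r - θ) • D r) volume θ 0 :=
    hD.continuousOn_smul (by fun_prop)
  rw [intervalIntegrable_iff_integrableOn_Ioc_of_le hθ.2] at hP hD2
  have e0 : max (-1 - θ) 0 = 0 := max_eq_right (by linarith [hθ.1])
  have e1 : max (0 - θ) 0 = 0 - θ := max_eq_left (by linarith [hθ.2])
  simp only [e0, e1, zero_smul, map_zero, sub_zero] at h
  rw [real_inner_smul_left, ← real_inner_smul_right, ← h, inner_add_left,
    real_inner_comm, real_inner_comm c, intervalIntegral.integral_of_le hθ.2,
    intervalIntegral.integral_of_le hθ.2, ← integral_inner hP, ← integral_inner hD2,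
    intervalIntegral.integral_of_le hθ.2, intervalIntegral.integral_of_le hθ.2]
  congr 1
  · refine setIntegral_congr_fun measurableSet_Ioc fun r hr => ?_
    rw [indicator_of_mem (show r ∈ Ioi θ from hr.1), real_inner_comm]
  · refine setIntegral_congr_fun measurableSet_Ioc fun r hr => ?_
    rw [max_eq_left (sub_nonneg.2 hr.1.le), real_inner_smul_right, real_inner_smul_right,
      real_inner_comm]

end NeutralSystem

/-! ### One-sided calculus on closed intervals -/

section Calculus

variable {E : Type*} [NormedAddCommGroup E] [NormedSpace ℝ E]

theorem ContinuousOn.hasDerivWithinAt_integral_Icc [CompleteSpace E] {p : ℝ → E} {a b c s : ℝ}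
    (hp : ContinuousOn p (Icc a b)) (hc : c ∈ Icc a b) (hs : s ∈ Icc a b) :
    HasDerivWithinAt (fun t => ∫ r in c..t, p r) (p s) (Icc a b) s := by
  have : Fact (s ∈ Icc a b) := ⟨hs⟩
  refine intervalIntegral.integral_hasDerivWithinAt_right ?_ ?_ (hp s hs)
  · exact (hp.mono (uIcc_subset_Icc hc hs)).intervalIntegrable
  · exact hp.stronglyMeasurableAtFilter_nhdsWithin measurableSet_Icc s

theorem ContinuousOn.hasDerivWithinAt_integral_left_Icc [CompleteSpace E] {p : ℝ → E}
    {a b c s : ℝ} (hp : ContinuousOn p (Icc a b)) (hc : c ∈ Icc a b) (hs : s ∈ Icc a b) :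
    HasDerivWithinAt (fun t => ∫ r in t..c, p r) (-p s) (Icc a b) s := by
  refine (hp.hasDerivWithinAt_integral_Icc hc hs).neg.congr (fun t _ => ?_) ?_ <;>
  exact intervalIntegral.integral_symm _ _

theorem eqOn_Icc_of_integral_eq [CompleteSpace E] {p q : ℝ → E} {a b : ℝ} (hab : a < b)
    (hp : ContinuousOn p (Icc a b)) (hq : ContinuousOn q (Icc a b))
    (h : ∀ s ∈ Icc a b, ∫ r in a..s, p r = ∫ r in a..s, q r) : EqOn p q (Icc a b) := by
  intro s hs
  have ha : a ∈ Icc a b := left_mem_Icc.2 hab.le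
  exact ((uniqueDiffOn_Icc hab) s hs).eq_deriv _ (hp.hasDerivWithinAt_integral_Icc ha hs)
    ((hq.hasDerivWithinAt_integral_Icc ha hs).congr h (h s hs))

/-- The product rule for a uniformly bounded family of operators which is only strongly
differentiable at `x t` and strongly continuous at `x'`. -/
theorem HasDerivWithinAt.clm_apply_of_norm_le {X : Type*} [NormedAddCommGroup X]
    [NormedSpace ℝ X] {M : ℝ → X →L[ℝ] E} {C : ℝ} (hM : ∀ t, ‖M t‖ ≤ C) {x : ℝ → X} {x' : X}
    {d : E} {I : Set ℝ} {t : ℝ} (hx : HasDerivWithinAt x x' I t)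
    (hc : ContinuousWithinAt (fun r => M r x') I t)
    (hd : HasDerivWithinAt (fun r => M r (x t)) d I t) :
    HasDerivWithinAt (fun r => M r (x r)) (d + M t x') I t := by
  rw [hasDerivWithinAt_iff_tendsto_slope] at hx hd ⊢
  -- The slope splits into that of `M r (x t)`, the term `M r x'`, and this error, which the uniform
  -- bound on `M` sends to zero.
  have h1 : Filter.Tendsto (fun r => M r (slope x t r - x')) (nhdsWithin t (I \ {t}))
      (nhds 0) := by
    refine squeeze_zero_norm (a := fun r => C * ‖slope x t r - x'‖)
      (fun r => (M r).le_of_opNorm_le (hM r) _) ?_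
    have := (hx.sub_const x').norm.const_mul C
    simpa using this
  have h2 : Filter.Tendsto (fun r => M r x') (nhdsWithin t (I \ {t})) (nhds (M t x')) :=
    hc.mono_left (nhdsWithin_mono _ sdiff_subset)
  have h3 := hd.add (h1.add h2)
  rw [zero_add] at h3
  refine h3.congr fun r => ?_
  simp only [slope_def_module, map_sub, map_smul, smul_sub]
  abel

theorem intervalIntegrable_clm_apply {F : Type*} [NormedAddCommGroup F] [NormedSpace ℝ F]
    {K : ℝ → E →L[ℝ] F} {u : ℝ → E} {a b : ℝ} (hab : a ≤ b)
    (hK : IntegrableOn K (Ioc a b)) (hu : ContinuousOn u (Icc a b)) :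
    IntervalIntegrable (fun τ => K τ (u τ)) volume a b := by
  rw [intervalIntegrable_iff_integrableOn_Ioc_of_le hab]
  obtain ⟨C, hC⟩ := isCompact_Icc.exists_bound_of_continuousOn hu
  refine Integrable.mono' (hK.norm.mul_const C) ?_ ?_
  · exact isBoundedBilinearMap_apply.continuous.comp_aestronglyMeasurable
      (hK.aestronglyMeasurable.prodMk
        ((hu.mono Ioc_subset_Icc_self).aestronglyMeasurable measurableSet_Ioc))
  · rw [ae_restrict_iff' measurableSet_Ioc]
    exact Filter.Eventually.of_forall fun τ hτ =>
      (K τ).le_opNorm_of_le (hC τ (Ioc_subset_Icc_self hτ))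

end Calculus

/-- The delay interval has length one, so the `L₁` norm is at most the `L₂` norm. -/
theorem HistorySpace.integral_norm_le {n : ℕ} (g : HistorySpace n) :
    ∫ r, ‖g r‖ ∂delayMeasure ≤ ‖g‖ := by
  have : IsProbabilityMeasure delayMeasure := ⟨by simp⟩
  rw [integral_norm_eq_lintegral_enorm (Lp.aestronglyMeasurable g), ← eLpNorm_one_eq_lintegral_enorm,
    Lp.norm_def]
  exact ENNReal.toReal_mono (Lp.eLpNorm_ne_top g)
    (eLpNorm_le_eLpNorm_of_exponent_le (by norm_num) (Lp.aestronglyMeasurable g))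

/-! ### Density of the domain of the generator -/

namespace NeutralSystem

variable {n : ℕ} (S : NeutralSystem n)

theorem fst_mem_domain_of_mem_generatorGraph {p : StateSpace n × StateSpace n}
    (hp : p ∈ S.generatorGraph) : p.1 ∈ S.generator.domain := by
  rw [← S.graph_generator] at hp
  exact LinearPMap.mem_domain_of_mem_graph hp

/-- The function `q(θ) = u - ∫_θ^0 (A₃ᵀ w - χ)`, where `y = (w, ψ)` and `z = (u, χ)`. -/
noncomputable def adjointProfile (y z : StateSpace n) (θ : ℝ) : Vec n :=
  z.fst - ∫ r in θ..0, (transposeCLM S.A₃ r y.fst - z.snd r)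

theorem continuousOn_adjointProfile (y z : StateSpace n) :
    ContinuousOn (S.adjointProfile y z) (Icc (-1) 0) := by
  refine continuousOn_const.sub ?_
  have hD := (S.memLp_adjoint_defect y.fst z.snd).intervalIntegrable_delay
    (a := -1) (b := 0) (by simp) (by simp)
  rw [intervalIntegrable_iff_integrableOn_Ioc_of_le (by norm_num)] at hD
  have := intervalIntegral.continuousOn_primitive_interval_left (μ := volume)
    (f := fun r => transposeCLM S.A₃ r y.fst - z.snd r) (a := -1) (b := 0)
    (by rwa [uIcc_of_le (by norm_num), integrableOn_Icc_iff_integrableOn_Ioc])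
  rwa [uIcc_of_le (by norm_num)] at this

/-- A vector `z` orthogonal to the domain satisfies the adjoint relation with `y = 0`. Its profile
then vanishes, which forces both components of `z` to be zero. Density is what makes `S.generator†`
a genuine adjoint. -/
theorem dense_generator_domain : Dense (S.generator.domain : Set (StateSpace n)) := by
  rw [Submodule.dense_iff_topologicalClosure_eq_top, Submodule.topologicalClosure_eq_top_iff,
    Submodule.eq_bot_iff]
  intro z hz
  have hm0 : (0 : ℝ) ∈ Icc (-1 : ℝ) 0 := by simp
  have hm1 : (-1 : ℝ) ∈ Icc (-1 : ℝ) 0 := by simp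
  have hyz : ∀ p ∈ S.generatorGraph, inner ℝ (0 : StateSpace n) p.2 = inner ℝ z p.1 := by
    intro p hp
    rw [inner_zero_left, (Submodule.mem_orthogonal' _ _).1 hz _
      (S.fst_mem_domain_of_mem_generatorGraph hp)]
  have hq := S.continuousOn_adjointProfile 0 z
  have hint : ∀ θ ∈ Icc (-1 : ℝ) 0, ∫ s in θ..0, S.adjointProfile 0 z s = 0 := by
    intro θ hθ
    have h := S.integral_adjoint_profile hyz hθ
    refine h.symm.trans ?_
    have : ∫ r in θ..0, (transposeCLM S.A₂ r (0 : StateSpace n).fst + (0 : StateSpace n).snd r) =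
        ∫ r in θ..0, (0 : Vec n) := by
      rw [intervalIntegral.integral_of_le hθ.2, intervalIntegral.integral_of_le hθ.2]
      refine integral_congr_ae ?_
      have h0 := ae_restrict_of_ae_restrict_of_subset (Ioc_subset_Ioc_left hθ.1)
        (Lp.coeFn_zero (Vec n) 2 delayMeasure)
      filter_upwards [h0] with r hr
      simp only [WithLp.zero_fst, WithLp.zero_snd, map_zero, zero_add]
      exact hr
    rw [this, intervalIntegral.integral_zero]
  have hq0 : EqOn (S.adjointProfile 0 z) (fun _ => 0) (Icc (-1) 0) := by
    refine eqOn_Icc_of_integral_eq (by norm_num) hq continuousOn_const fun s hs => ?_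
    have hi : ∀ {c d : ℝ}, c ∈ Icc (-1 : ℝ) 0 → d ∈ Icc (-1 : ℝ) 0 →
        IntervalIntegrable (S.adjointProfile 0 z) volume c d :=
      fun hc hd => (hq.mono (uIcc_subset_Icc hc hd)).intervalIntegrable
    have := intervalIntegral.integral_add_adjacent_intervals (hi hm1 hs) (hi hs hm0)
    rw [hint s hs, hint _ hm1, add_zero] at this
    rw [this, intervalIntegral.integral_zero]
  have hu : z.fst = 0 := by
    have := hq0 hm0
    simpa [adjointProfile] using this
  have hχ : ∀ θ ∈ Icc (-1 : ℝ) 0, ∫ r in θ..0, z.snd r = 0 := by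
    intro θ hθ
    have := hq0 hθ
    simpa [adjointProfile, hu] using this
  have hsnd : z.snd = 0 := by
    -- All primitives of `z.snd` vanish, so it is a weak derivative of the zero function.
    refine (IsH1With.eq_zero (f := 0) (g := z.snd) ⟨Lp.coeFn_zero _ _ _, fun θ hθ => ?_⟩).2
    have := intervalIntegral.integral_add_adjacent_intervals
      ((Lp.memLp z.snd).intervalIntegrable_delay hm1 hθ)
      ((Lp.memLp z.snd).intervalIntegrable_delay hθ hm0)
    rw [hχ θ hθ, hχ _ hm1, add_zero] at this
    rw [this]
    simp
  exact WithLp.ofLp_injective 2 (Prod.ext hu hsnd)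

theorem inner_adjoint_generator (y : S.generator†.domain) {p : StateSpace n × StateSpace n}
    (hp : p ∈ S.generatorGraph) :
    inner ℝ (y : StateSpace n) p.2 = inner ℝ (S.generator† y) p.1 := by
  rw [← S.graph_generator, LinearPMap.mem_graph_iff] at hp
  obtain ⟨v, h1, h2⟩ := hp
  rw [← h1, ← h2]
  exact (LinearPMap.adjoint_isFormalAdjoint S.dense_generator_domain y v).symm

/-! ### Integrated profiles as bounded functionals -/

theorem integrableOn_transposeCLM {A : ℝ → Matrix (Fin n) (Fin n) ℝ}
    (hA : ∀ i j, MemLp (fun θ => A θ i j) 2 delayMeasure) :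
    IntegrableOn (transposeCLM A) (Ioc (-1) 0) :=
  (memLp_transposeCLM hA).integrable (by norm_num)

theorem integrable_adjoint_profile (y : StateSpace n) :
    Integrable (fun r => transposeCLM S.A₂ r y.fst + y.snd r) delayMeasure :=
  (S.memLp_adjoint_profile y.fst y.snd).integrable (by norm_num)

/-- Enlarging the domain to the whole delay interval gives a constant independent of `θ`.
Integrating against `delayMeasure` makes this valid for every real `θ`, as
`HasDerivWithinAt.clm_apply_of_norm_le` requires. -/
theorem norm_integral_adjoint_profile_le (θ : ℝ) (y : StateSpace n) :
    ‖∫ r in Ioc θ 0, (transposeCLM S.A₂ r y.fst + y.snd r) ∂delayMeasure‖ ≤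
      ((∫ r, ‖transposeCLM S.A₂ r‖ ∂delayMeasure) + 1) * ‖y‖ := by
  have hK : Integrable (transposeCLM S.A₂) delayMeasure := integrableOn_transposeCLM S.memLp_A₂
  have hψ : Integrable y.snd delayMeasure := (Lp.memLp _).integrable (by norm_num)
  have hf : ‖y.fst‖ ≤ ‖y‖ := WithLp.norm_fst_le _ y
  have hs : ‖y.snd‖ ≤ ‖y‖ := WithLp.norm_snd_le _ y
  calc _ ≤ ∫ r in Ioc θ 0, ‖transposeCLM S.A₂ r y.fst + y.snd r‖ ∂delayMeasure :=
        norm_integral_le_integral_norm _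
    _ ≤ ∫ r, ‖transposeCLM S.A₂ r y.fst + y.snd r‖ ∂delayMeasure :=
        setIntegral_le_integral (S.integrable_adjoint_profile y).norm
          (Filter.Eventually.of_forall fun _ => norm_nonneg _)
    _ ≤ ∫ r, (‖transposeCLM S.A₂ r‖ * ‖y‖ + ‖y.snd r‖) ∂delayMeasure :=
        integral_mono (S.integrable_adjoint_profile y).norm ((hK.norm.mul_const _).add hψ.norm)
          fun r => (norm_add_le _ _).trans
            (add_le_add_left ((transposeCLM S.A₂ r).le_opNorm_of_le hf) _)
    _ = (∫ r, ‖transposeCLM S.A₂ r‖ ∂delayMeasure) * ‖y‖ + ∫ r, ‖y.snd r‖ ∂delayMeasure := by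
        rw [integral_add (hK.norm.mul_const _) hψ.norm, integral_mul_const]
    _ ≤ _ := by
        rw [add_mul, one_mul]
        exact add_le_add_right ((HistorySpace.integral_norm_le _).trans hs) _

/-- The functional `(w, ψ) ↦ ∫_θ^0 (A₂ᵀ w + ψ)`. -/
noncomputable def profileIntegral (θ : ℝ) : StateSpace n →L[ℝ] Vec n :=
  LinearMap.mkContinuous
    { toFun := fun y => ∫ r in Ioc θ 0, (transposeCLM S.A₂ r y.fst + y.snd r) ∂delayMeasure
      map_add' := fun y z => by
        rw [← integral_add (S.integrable_adjoint_profile y).integrableOn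
          (S.integrable_adjoint_profile z).integrableOn]
        refine integral_congr_ae (ae_restrict_of_ae ?_)
        filter_upwards [Lp.coeFn_add y.snd z.snd] with r hr
        rw [WithLp.add_fst, WithLp.add_snd, hr, map_add, Pi.add_apply]
        abel
      map_smul' := fun c y => by
        rw [RingHom.id_apply, ← integral_smul]
        refine integral_congr_ae (ae_restrict_of_ae ?_)
        filter_upwards [Lp.coeFn_smul c y.snd] with r hr
        rw [WithLp.smul_fst, WithLp.smul_snd, hr, map_smul, Pi.smul_apply, smul_add] }
    ((∫ r, ‖transposeCLM S.A₂ r‖ ∂delayMeasure) + 1) (S.norm_integral_adjoint_profile_le θ)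

theorem norm_profileIntegral_le (θ : ℝ) :
    ‖S.profileIntegral θ‖ ≤ (∫ r, ‖transposeCLM S.A₂ r‖ ∂delayMeasure) + 1 :=
  LinearMap.mkContinuous_norm_le _ (by positivity) _

theorem profileIntegral_apply {θ : ℝ} (hθ : θ ∈ Icc (-1 : ℝ) 0) (y : StateSpace n) :
    S.profileIntegral θ y = ∫ r in θ..0, (transposeCLM S.A₂ r y.fst + y.snd r) := by
  change ∫ r in Ioc θ 0, (transposeCLM S.A₂ r y.fst + y.snd r) ∂delayMeasure = _
  rw [intervalIntegral.integral_of_le hθ.2,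
    Measure.restrict_restrict measurableSet_Ioc,
    inter_eq_left.2 (Ioc_subset_Ioc_left hθ.1)]

theorem continuousOn_profileIntegral_apply (y : StateSpace n) :
    ContinuousOn (fun θ => S.profileIntegral θ y) (Icc (-1) 0) := by
  refine ContinuousOn.congr ?_ fun θ hθ => S.profileIntegral_apply hθ y
  have := intervalIntegral.continuousOn_primitive_interval_left (μ := volume)
    (f := fun r => transposeCLM S.A₂ r y.fst + y.snd r) (a := -1) (b := 0)
    (by
      rw [uIcc_of_le (by norm_num), integrableOn_Icc_iff_integrableOn_Ioc]
      exact S.integrable_adjoint_profile y)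
  rwa [uIcc_of_le (by norm_num)] at this

/-- The operator `B(θ) = ∫_θ^0 Aᵀ`. -/
noncomputable def primitiveCLM (A : ℝ → Matrix (Fin n) (Fin n) ℝ) (θ : ℝ) : Vec n →L[ℝ] Vec n :=
  ∫ τ in θ..0, transposeCLM A τ

theorem continuousOn_primitiveCLM {A : ℝ → Matrix (Fin n) (Fin n) ℝ}
    (hA : ∀ i j, MemLp (fun θ => A θ i j) 2 delayMeasure) :
    ContinuousOn (primitiveCLM A) (Icc (-1) 0) := by
  have := intervalIntegral.continuousOn_primitive_interval_left (μ := volume)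
    (f := transposeCLM A) (a := -1) (b := 0)
    (by
      rw [uIcc_of_le (by norm_num), integrableOn_Icc_iff_integrableOn_Ioc]
      exact integrableOn_transposeCLM hA)
  rwa [uIcc_of_le (by norm_num)] at this

theorem primitiveCLM_apply {A : ℝ → Matrix (Fin n) (Fin n) ℝ}
    (hA : ∀ i j, MemLp (fun θ => A θ i j) 2 delayMeasure) {θ : ℝ} (hθ : θ ∈ Icc (-1 : ℝ) 0)
    (v : Vec n) : primitiveCLM A θ v = ∫ τ in θ..0, transposeCLM A τ v :=
  ContinuousLinearMap.intervalIntegral_apply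
    ((memLp_transposeCLM hA).intervalIntegrable_delay hθ (by simp)) v

/-- Eliminates the history component: by definition of `q`, `∫_θ^0 χ = q(θ) - u + ∫_θ^0 A₃ᵀ w`. The
profile is isolated as a summand so that it can cancel later. -/
theorem profileIntegral_add_defect (y z : StateSpace n) {θ : ℝ} (hθ : θ ∈ Icc (-1 : ℝ) 0) :
    S.profileIntegral θ z = S.adjointProfile y z θ +
      (primitiveCLM S.A₂ θ z.fst + primitiveCLM S.A₃ θ y.fst - z.fst) := by
  have hm0 : (0 : ℝ) ∈ Icc (-1 : ℝ) 0 := by simp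
  have h2 := (memLp_transposeCLM_apply S.memLp_A₂ z.fst).intervalIntegrable_delay hθ hm0
  have h3 := (memLp_transposeCLM_apply S.memLp_A₃ y.fst).intervalIntegrable_delay hθ hm0
  have hz := (Lp.memLp z.snd).intervalIntegrable_delay hθ hm0
  rw [S.profileIntegral_apply hθ, adjointProfile, primitiveCLM_apply S.memLp_A₂ hθ,
    primitiveCLM_apply S.memLp_A₃ hθ, intervalIntegral.integral_add h2 hz,
    intervalIntegral.integral_sub h3 hz]
  abel

/-! ### Transport along characteristics -/

section Transport

variable {S} {a : ℝ} {x z : ℝ → StateSpace n}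

theorem hasDerivWithinAt_profileIntegral_characteristic
    (hxz : ∀ t ∈ Icc a (a + 1), ∀ p ∈ S.generatorGraph, inner ℝ (x t) p.2 = inner ℝ (z t) p.1)
    (hx : ∀ t ∈ Icc a (a + 1), HasDerivWithinAt x (z t) (Icc a (a + 1)) t)
    {s t : ℝ} (hs : s ∈ Icc a (a + 1)) (ht : t ∈ Icc a s) :
    HasDerivWithinAt (fun r => S.profileIntegral (r - s) (x r))
      (primitiveCLM S.A₂ (t - s) (z t).fst + primitiveCLM S.A₃ (t - s) (x t).fst - (z t).fst)
      (Icc a s) t := by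
  have hsub : Icc a s ⊆ Icc a (a + 1) := Icc_subset_Icc_right hs.2
  have hmaps : MapsTo (fun r => r - s) (Icc a s) (Icc (-1) 0) := fun r hr =>
    ⟨by linarith [hr.1, hs.2], by linarith [hr.2]⟩
  have hθ := hmaps ht
  -- With the state frozen, the integrand may be replaced by the continuous `q`, so the integral is
  -- differentiable in its lower limit at every point.
  have hd : HasDerivWithinAt (fun r => S.profileIntegral (r - s) (x t))
      (-S.adjointProfile (x t) (z t) (t - s)) (Icc a s) t := by
    have h1 := (S.continuousOn_adjointProfile (x t) (z t)).hasDerivWithinAt_integral_left_Icc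
      (c := 0) (by simp) hθ
    have h2 := h1.scomp t ((hasDerivWithinAt_id t (Icc a s)).sub_const s) hmaps
    rw [one_smul] at h2
    have h3 : ∀ r ∈ Icc a s, S.profileIntegral (r - s) (x t) =
        ∫ ρ in (r - s)..0, S.adjointProfile (x t) (z t) ρ := fun r hr => by
      rw [S.profileIntegral_apply (hmaps hr)]
      exact S.integral_adjoint_profile (hxz t (hsub ht)) (hmaps hr)
    exact h2.congr h3 (h3 t ht)
  have hc : ContinuousWithinAt (fun r => S.profileIntegral (r - s) (z t)) (Icc a s) t :=
    ((S.continuousOn_profileIntegral_apply (z t)) _ hθ).comp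
      (f := fun r => r - s) (by fun_prop) hmaps
  have h := ((hx t (hsub ht)).mono hsub).clm_apply_of_norm_le
    (M := fun r => S.profileIntegral (r - s)) (fun r => S.norm_profileIntegral_le _) hc hd
  rwa [S.profileIntegral_add_defect (x t) (z t) hθ, neg_add_cancel_left] at h

/-- The fundamental theorem of calculus along the characteristic ending at `θ = 0` at time `s`, with
Fubini applied to the two coefficient terms. -/
theorem integral_characteristic_eq
    (hxz : ∀ t ∈ Icc a (a + 1), ∀ p ∈ S.generatorGraph, inner ℝ (x t) p.2 = inner ℝ (z t) p.1)
    (hx : ∀ t ∈ Icc a (a + 1), HasDerivWithinAt x (z t) (Icc a (a + 1)) t)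
    (hz : ContinuousOn z (Icc a (a + 1))) {s : ℝ} (hs : s ∈ Icc a (a + 1)) :
    ∫ σ in a..s, ((z σ).fst - ((∫ τ in (a - σ)..0, transposeCLM S.A₂ τ (z (σ + τ)).fst) +
        ∫ τ in (a - σ)..0, transposeCLM S.A₃ τ (x (σ + τ)).fst)) =
      ∫ σ in a..s, S.adjointProfile (x a) (z a) (a - σ) := by
  have hsub : Icc a s ⊆ Icc a (a + 1) := Icc_subset_Icc_right hs.2
  have hmaps : MapsTo (fun r => r - s) (Icc a s) (Icc (-1) 0) := fun r hr =>
    ⟨by linarith [hr.1, hs.2], by linarith [hr.2]⟩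
  have ha : a ∈ Icc a s := left_mem_Icc.2 hs.1
  have hzf : ContinuousOn (fun t => (z t).fst) (Icc a (a + 1)) :=
    (WithLp.fstL 2 ℝ (Vec n) (HistorySpace n)).continuous.comp_continuousOn hz
  have hxf : ContinuousOn (fun t => (x t).fst) (Icc a (a + 1)) :=
    (WithLp.fstL 2 ℝ (Vec n) (HistorySpace n)).continuous.comp_continuousOn
      fun t ht => (hx t ht).continuousWithinAt
  have hK2 := integrableOn_transposeCLM S.memLp_A₂
  have hK3 := integrableOn_transposeCLM S.memLp_A₃
  have hB : ∀ {A : ℝ → Matrix (Fin n) (Fin n) ℝ} {u : ℝ → Vec n},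
      (∀ i j, MemLp (fun θ => A θ i j) 2 delayMeasure) → ContinuousOn u (Icc a (a + 1)) →
      ContinuousOn (fun t => primitiveCLM A (t - s) (u t)) (Icc a s) := fun hA hu =>
    ((continuousOn_primitiveCLM hA).comp (f := fun r => r - s) (by fun_prop) hmaps).clm_apply
      (hu.mono hsub)
  have hint : ∀ {p : ℝ → Vec n}, ContinuousOn p (Icc a s) → IntervalIntegrable p volume a s :=
    fun hp => (hp.mono (uIcc_of_le hs.1).subset).intervalIntegrable
  have hi2 := hint (hB S.memLp_A₂ hzf)
  have hi3 := hint (hB S.memLp_A₃ hxf)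
  have hiz := hint (hzf.mono hsub)
  have hder := fun t (ht : t ∈ Icc a s) =>
    hasDerivWithinAt_profileIntegral_characteristic hxz hx hs ht
  have hftc := intervalIntegral.integral_eq_sub_of_hasDerivAt_of_le hs.1
    (fun t ht => (hder t ht).continuousWithinAt)
    (fun t ht => (hder t (Ioo_subset_Icc_self ht)).hasDerivAt (Icc_mem_nhds ht.1 ht.2))
    ((hi2.add hi3).sub hiz)
  have h0 : S.profileIntegral (s - s) (x s) = 0 := by
    rw [sub_self, S.profileIntegral_apply (by simp), intervalIntegral.integral_same]
  have h1 : S.profileIntegral (a - s) (x a) =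
      ∫ σ in a..s, S.adjointProfile (x a) (z a) (a - σ) := by
    rw [intervalIntegral.integral_comp_sub_left (fun θ => S.adjointProfile (x a) (z a) θ),
      sub_self, S.profileIntegral_apply (hmaps ha)]
    exact S.integral_adjoint_profile (hxz a (hsub ha)) (hmaps ha)
  have hv2 := integral_primitive_eq_integral_volterra hK2 hzf hs
  have hv3 := integral_primitive_eq_integral_volterra hK3 hxf hs
  have hN2 := hint ((continuousOn_volterra hK2 hzf).mono hsub)
  have hN3 := hint ((continuousOn_volterra hK3 hxf).mono hsub)
  rw [h0, h1, intervalIntegral.integral_sub (hi2.add hi3) hiz,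
    intervalIntegral.integral_add hi2 hi3] at hftc
  rw [intervalIntegral.integral_sub hiz (hN2.add hN3), intervalIntegral.integral_add hN2 hN3,
    ← hv2, ← hv3, ← neg_inj, neg_sub, ← zero_sub (∫ σ in a..s, S.adjointProfile _ _ _)]
  exact hftc

/-- The neutral equation satisfied by the first component, on an interval of length one. -/
theorem fst_deriv_eq_of_adjoint
    (hxz : ∀ t ∈ Icc a (a + 1), ∀ p ∈ S.generatorGraph, inner ℝ (x t) p.2 = inner ℝ (z t) p.1)
    (hx : ∀ t ∈ Icc a (a + 1), HasDerivWithinAt x (z t) (Icc a (a + 1)) t)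
    (hz : ContinuousOn z (Icc a (a + 1))) :
    IntervalIntegrable (fun τ => transposeCLM S.A₂ τ (z (a + 1 + τ)).fst +
        transposeCLM S.A₃ τ (x (a + 1 + τ)).fst) volume (-1) 0 ∧
      (z (a + 1)).fst = Matrix.toEuclideanLin S.A₁.transpose (z a).fst +
        ∫ τ in (-1 : ℝ)..0, (transposeCLM S.A₂ τ (z (a + 1 + τ)).fst +
          transposeCLM S.A₃ τ (x (a + 1 + τ)).fst) := by
  have hzf : ContinuousOn (fun t => (z t).fst) (Icc a (a + 1)) :=
    (WithLp.fstL 2 ℝ (Vec n) (HistorySpace n)).continuous.comp_continuousOn hz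
  have hxf : ContinuousOn (fun t => (x t).fst) (Icc a (a + 1)) :=
    (WithLp.fstL 2 ℝ (Vec n) (HistorySpace n)).continuous.comp_continuousOn
      fun t ht => (hx t ht).continuousWithinAt
  have hK2 := integrableOn_transposeCLM S.memLp_A₂
  have hK3 := integrableOn_transposeCLM S.memLp_A₃
  have hshift : MapsTo (fun τ => a + 1 + τ) (Icc (-1) 0) (Icc a (a + 1)) := fun τ hτ =>
    ⟨by linarith [hτ.1], by linarith [hτ.2]⟩
  have hi2 : IntervalIntegrable
      (fun τ => transposeCLM S.A₂ τ (z (a + 1 + τ)).fst) volume (-1) 0 :=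
    intervalIntegrable_clm_apply (by norm_num) hK2
    (hzf.comp (f := fun τ => a + 1 + τ) (by fun_prop) hshift)
  have hi3 : IntervalIntegrable
      (fun τ => transposeCLM S.A₃ τ (x (a + 1 + τ)).fst) volume (-1) 0 :=
    intervalIntegrable_clm_apply (by norm_num) hK3
    (hxf.comp (f := fun τ => a + 1 + τ) (by fun_prop) hshift)
  refine ⟨hi2.add hi3, ?_⟩
  have hm : a + 1 ∈ Icc a (a + 1) := by simp
  have ha : a ∈ Icc a (a + 1) := by simp
  -- Continuity of both integrands gives equality everywhere on the closed interval, including the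
  -- end point `a + 1` needed here.
  have heq := eqOn_Icc_of_integral_eq (lt_add_one a)
    (hzf.sub ((continuousOn_volterra hK2 hzf).add (continuousOn_volterra hK3 hxf)))
    ((S.continuousOn_adjointProfile (x a) (z a)).comp (f := fun σ => a - σ) (by fun_prop)
      fun σ hσ => ⟨by linarith [hσ.2], by linarith [hσ.1]⟩)
    (fun s hs => integral_characteristic_eq hxz hx hz hs) hm
  -- At `θ = -1` the boundary condition on the adjoint domain produces the `A₁` term.
  have hA1 : S.adjointProfile (x a) (z a) (-1) =
      Matrix.toEuclideanLin S.A₁.transpose (z a).fst := by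
    rw [adjointProfile, S.integral_adjoint_defect (hxz a ha), sub_sub_cancel]
  have e : a - (a + 1) = -1 := by ring
  simp only [Pi.sub_apply, Pi.add_apply, Function.comp_apply, e, hA1] at heq
  rw [intervalIntegral.integral_add hi2 hi3]
  exact sub_eq_iff_eq_add.1 heq

end Transport

end NeutralSystem

/-! ### From the abstract solution to its first component -/

theorem derivWithin_fst_toLp {n : ℕ} {w : ℝ → Vec n} {ψ : ℝ → HistorySpace n} {J : Set ℝ} {t : ℝ}
    {x' : StateSpace n} (h : HasDerivWithinAt (fun t => WithLp.toLp 2 (w t, ψ t)) x' J t) :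
    derivWithin w J t =
      (derivWithin (fun t => (WithLp.toLp 2 (w t, ψ t) : StateSpace n)) J t).fst := by
  by_cases hJ : UniqueDiffWithinAt ℝ J t
  · have hw : HasDerivWithinAt w x'.fst J t :=
      (WithLp.fstL 2 ℝ (Vec n) (HistorySpace n)).hasFDerivAt.comp_hasDerivWithinAt t h
    rw [h.derivWithin hJ, hw.derivWithin hJ]
  -- For a degenerate `J`, such as a single point, both sides take the default value `0`.
  · rw [derivWithin_zero_of_not_uniqueDiffWithinAt hJ,
      derivWithin_zero_of_not_uniqueDiffWithinAt hJ, WithLp.zero_fst]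

theorem mainTheorem5 (n : ℕ) (S : NeutralSystem n) (J : Set ℝ) (hJ : J.OrdConnected)
    (w : ℝ → Vec n) (ψ : ℝ → HistorySpace n)
    (hx : IsClassicalSolutionOn S.generator† (fun t => WithLp.toLp 2 (w t, ψ t)) J) :
    (∀ t ∈ J, DifferentiableWithinAt ℝ w J t) ∧ ContinuousOn (derivWithin w J) J ∧
      ∀ t, t ∈ J → t + 1 ∈ J →
        IntervalIntegrable (fun τ =>
          Matrix.toEuclideanLin (S.A₂ τ).transpose (derivWithin w J (t + 1 + τ)) +
            Matrix.toEuclideanLin (S.A₃ τ).transpose (w (t + 1 + τ))) volume (-1) 0 ∧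
        derivWithin w J (t + 1) =
          Matrix.toEuclideanLin S.A₁.transpose (derivWithin w J t) +
            ∫ τ in (-1 : ℝ)..0,
              (Matrix.toEuclideanLin (S.A₂ τ).transpose (derivWithin w J (t + 1 + τ)) +
                Matrix.toEuclideanLin (S.A₃ τ).transpose (w (t + 1 + τ))) := by
  set x : ℝ → StateSpace n := fun t => WithLp.toLp 2 (w t, ψ t) with hxdef
  have hd : ∀ t ∈ J, derivWithin w J t = (derivWithin x J t).fst := fun t ht =>
    derivWithin_fst_toLp (hx.hasDerivWithinAt t ht)
  refine ⟨fun t ht => ?_, ?_, fun t ht ht1 => ?_⟩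
  · exact ((WithLp.fstL 2 ℝ (Vec n) (HistorySpace n)).hasFDerivAt.comp_hasDerivWithinAt t
      (hx.hasDerivWithinAt t ht)).differentiableWithinAt
  · exact ((WithLp.fstL 2 ℝ (Vec n) (HistorySpace n)).continuous.comp_continuousOn
      hx.continuousOn_deriv).congr hd
  · have hsub : Icc t (t + 1) ⊆ J := hJ.out ht ht1
    -- `J` contains an interval of length one, so it has interior and `derivWithin` is the
    -- derivative given by the equation.
    have huniq : UniqueDiffOn ℝ J :=
      uniqueDiffOn_convex hJ.convex
        ⟨t + 1 / 2, interior_mono hsub (by rw [interior_Icc]; constructor <;> linarith)⟩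
    have hz : ∀ r (hr : r ∈ J), derivWithin x J r = S.generator† ⟨x r, hx.mem_domain r hr⟩ :=
      fun r hr => (hx.hasDerivWithinAt r hr).derivWithin (huniq r hr)
    obtain ⟨h1, h2⟩ := NeutralSystem.fst_deriv_eq_of_adjoint (S := S) (a := t) (x := x)
      (z := derivWithin x J)
      (fun r hr p hp => by
        rw [hz r (hsub hr)]
        exact S.inner_adjoint_generator ⟨x r, hx.mem_domain r (hsub hr)⟩ hp)
      (fun r hr => by
        rw [hz r (hsub hr)]
        exact (hx.hasDerivWithinAt r (hsub hr)).mono hsub)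
      (hx.continuousOn_deriv.mono hsub)
    have hcongr : ∀ τ ∈ uIcc (-1 : ℝ) 0,
        transposeCLM S.A₂ τ (derivWithin x J (t + 1 + τ)).fst +
          transposeCLM S.A₃ τ (x (t + 1 + τ)).fst =
        Matrix.toEuclideanLin (S.A₂ τ).transpose (derivWithin w J (t + 1 + τ)) +
          Matrix.toEuclideanLin (S.A₃ τ).transpose (w (t + 1 + τ)) := by
      intro τ hτ
      rw [uIcc_of_le (by norm_num)] at hτ
      rw [hd _ (hsub ⟨by linarith [hτ.1], by linarith [hτ.2]⟩), transposeCLM_apply,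
        transposeCLM_apply]
      rfl
    refine ⟨h1.congr fun τ hτ => hcongr τ (uIoc_subset_uIcc hτ), ?_⟩
    rw [hd _ ht1, hd _ ht, h2, intervalIntegral.integral_congr hcongr]
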